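/- Let $\omega$ be a nonreal cube root of unity. Consider the seven three-qubit states $$\tfrac12(|000\rangle+|011\rangle+|101\rangle+|110\rangle),\quad \tfrac12(|000\rangle+|011\rangle-|101\rangle-|110\rangle),$$ $$\tfrac12(|000\rangle-|011\rangle+|101\rangle-|110\rangle),\quad \tfrac12(|000\rangle-|011\rangle-|101\rangle+|110\rangle),$$ $$\tfrac1{\sqrt3}(|001\rangle+|010\rangle+|100\rangle),\quad \tfrac1{\sqrt3}(|001\rangle+\omega|010\rangle+\omega^2|100\rangle),\quad \tfrac1{\sqrt3}(|001\rangle+\omega^2|010\rangle+\omega|100\rangle)$$ in $\mathbb{C}^2\otimes\mathbb{C}^2\otimes\mathbb{C}^2$. The first four belong to the GHZ class and the last three to the W class, that is, they are obtained by invertible local operators $A\otimes B\otimes C$ from $\frac{1}{\sqrt2}(|000\rangle+|111\rangle)$ and from $\frac1{\sqrt3}(|001\rangle+|010\rangle+|100\rangle)$, respectively. The seven states form an unextendible entangled basis of cardinality seven: they are orthonormal and entangled (not fully separable), they span a proper subspace, and every vector of its orthogonal complement is fully separable. The same holds across each of the three bipartitions: the states are entangled across the bipartition, and every vector of the complement is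 a product across it. The complement is spanned by $|111\rangle$, and the seven states together with $|111\rangle$ form an orthonormal basis of the whole space. The measurement in this completed basis is a nonlocal operation: it cannot be implemented by local operations and classical communication (LOCC) of the three parties. Moreover, for every pure three-qubit state $\psi$, entangled or not, it cannot be implemented by LOCC even if the three parties share $\psi$, one qubit each, as a resource. Here the measurement is implemented by LOCC if its outcome probabilities on all pure input states are reproduced, up to arbitrarily small error, by LOCC protocols with finitely many rounds (this includes exact implementations and protocols with infinitely many rounds). -/

import Mathlib

noncomputable section

namespace ThreeQubit

/-! ### Three-party pure states -/

/-- The Hilbert space `ℂ^a ⊗ ℂ^b ⊗ ℂ^c` shared by Alice, Bob and Charlie, in coordinates with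
respect to the computational product basis: `v (i, j, k)` is the coefficient of `|i j k⟩`. -/
abbrev State (a b c : ℕ) : Type := EuclideanSpace ℂ (Fin a × Fin b × Fin c)

/-- The space of three qubits. -/
abbrev Qubits : Type := State 2 2 2

/-- The computational basis vector `|i j k⟩`. -/
def ket (i j k : Fin 2) : Qubits := EuclideanSpace.single (i, j, k) 1

/-- `K ⊗ 1 ⊗ 1`. -/
def actA {a b c a' : ℕ} (K : Matrix (Fin a') (Fin a) ℂ) (v : State a b c) : State a' b c :=
  WithLp.toLp 2 fun t => ∑ i, K t.1 i * v (i, t.2.1, t.2.2)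

/-- `1 ⊗ K ⊗ 1`. -/
def actB {a b c b' : ℕ} (K : Matrix (Fin b') (Fin b) ℂ) (v : State a b c) : State a b' c :=
  WithLp.toLp 2 fun t => ∑ j, K t.2.1 j * v (t.1, j, t.2.2)

/-- `1 ⊗ 1 ⊗ K`. -/
def actC {a b c c' : ℕ} (K : Matrix (Fin c') (Fin c) ℂ) (v : State a b c) : State a b c' :=
  WithLp.toLp 2 fun t => ∑ k, K t.2.2 k * v (t.1, t.2.1, k)

/-- The joint state `v ⊗ w` of two three-party systems, regrouped party by party: Alice holds the
first factors of both systems, Bob the second ones and Charlie the third ones. The index of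
`ℂ^a ⊗ ℂ^a'` is `Fin (a * a')` through the usual bijection with `Fin a × Fin a'`. -/
def tensor {a b c a' b' c' : ℕ} (v : State a b c) (w : State a' b' c') :
    State (a * a') (b * b') (c * c') :=
  WithLp.toLp 2 fun t =>
    v (t.1.divNat, t.2.1.divNat, t.2.2.divNat) * w (t.1.modNat, t.2.1.modNat, t.2.2.modNat)

/-! ### Separability, entanglement classes and unextendible entangled bases -/

/-- The vector is a product `x ⊗ y ⊗ z` (fully separable). -/
def IsFullyProduct (v : Qubits) : Prop :=
  ∃ x y z : Fin 2 → ℂ, ∀ i j k, v (i, j, k) = x i * y j * z k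

/-- The three bipartitions of three parties. -/
inductive Cut
  | A_BC
  | B_AC
  | C_AB

/-- The vector is a product across the given bipartition. -/
def IsProductAcross : Cut → Qubits → Prop
  | .A_BC, v => ∃ (x : Fin 2 → ℂ) (y : Fin 2 × Fin 2 → ℂ), ∀ i j k, v (i, j, k) = x i * y (j, k)
  | .B_AC, v => ∃ (x : Fin 2 → ℂ) (y : Fin 2 × Fin 2 → ℂ), ∀ i j k, v (i, j, k) = x j * y (i, k)
  | .C_AB, v => ∃ (x : Fin 2 → ℂ) (y : Fin 2 × Fin 2 → ℂ), ∀ i j k, v (i, j, k) = x k * y (i, j)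

/-- A family of states is an unextendible entangled basis with respect to a notion `IsProd` of
unentangled pure states: the states are orthonormal and entangled, they span a proper subspace, and
the complementary subspace contains no entangled state. -/
def IsUEB (IsProd : Qubits → Prop) {n : ℕ} (s : Fin n → Qubits) : Prop :=
  Orthonormal ℂ s ∧ (∀ m, ¬ IsProd (s m)) ∧
    Submodule.span ℂ (Set.range s) ≠ ⊤ ∧
    ∀ v ∈ (Submodule.span ℂ (Set.range s))ᗮ, IsProd v

/-- Equivalence under stochastic LOCC: the vectors are related by invertible local operators. -/
def SLOCCEquivalent (v w : Qubits) : Prop :=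
  ∃ A B C : Matrix (Fin 2) (Fin 2) ℂ, IsUnit A ∧ IsUnit B ∧ IsUnit C ∧
    w = actA A (actB B (actC C v))

/-- The Greenberger-Horne-Zeilinger state `(|000⟩ + |111⟩) / √2`. -/
def ghz : Qubits := (1 / (Real.sqrt 2 : ℂ)) • (ket 0 0 0 + ket 1 1 1)

/-- The W state `(|001⟩ + |010⟩ + |100⟩) / √3`. -/
def wState : Qubits := (1 / (Real.sqrt 3 : ℂ)) • (ket 0 0 1 + ket 0 1 0 + ket 1 0 0)

/-- The GHZ class. -/
def IsGHZClass (v : Qubits) : Prop := SLOCCEquivalent ghz v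

/-- The W class. -/
def IsWClass (v : Qubits) : Prop := SLOCCEquivalent wState v

/-! ### The states -/

/-- The seven states; `ω` is a nonreal cube root of unity. -/
def sevenStates (ω : ℂ) : Fin 7 → Qubits :=
  ![(1 / 2 : ℂ) • (ket 0 0 0 + ket 0 1 1 + ket 1 0 1 + ket 1 1 0),
    (1 / 2 : ℂ) • (ket 0 0 0 + ket 0 1 1 - ket 1 0 1 - ket 1 1 0),
    (1 / 2 : ℂ) • (ket 0 0 0 - ket 0 1 1 + ket 1 0 1 - ket 1 1 0),
    (1 / 2 : ℂ) • (ket 0 0 0 - ket 0 1 1 - ket 1 0 1 + ket 1 1 0),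
    (1 / (Real.sqrt 3 : ℂ)) • (ket 0 0 1 + ket 0 1 0 + ket 1 0 0),
    (1 / (Real.sqrt 3 : ℂ)) • (ket 0 0 1 + ω • ket 0 1 0 + ω ^ 2 • ket 1 0 0),
    (1 / (Real.sqrt 3 : ℂ)) • (ket 0 0 1 + ω ^ 2 • ket 0 1 0 + ω • ket 1 0 0)]

/-- The seven states followed by `|111⟩`. -/
def completedBasis (ω : ℂ) : Fin 8 → Qubits :=
  Fin.snoc (α := fun _ => Qubits) (sevenStates ω) (ket 1 1 1)

/-! ### LOCC measurements -/

/-- Finite-round three-party LOCC protocols that end with the announcement of an outcome in `O`,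
acting on local systems of dimensions `a`, `b`, `c`. Either the protocol stops and announces an
outcome, or one of the parties performs a quantum measurement on its own system (finitely many
Kraus operators `K x` with `∑ x, (K x)ᴴ * K x = 1`, with output systems of arbitrary dimensions, so
that local ancillas, local unitaries, local randomness and discarding are included) and tells the
result `x` to the others, and the rest of the protocol is chosen depending on `x`. -/
inductive LOCC (O : Type) : ℕ → ℕ → ℕ → Type
  | done {a b c : ℕ} (o : O) : LOCC O a b c
  | alice {a b c : ℕ} (n : ℕ) (a' : Fin n → ℕ) (K : ∀ x, Matrix (Fin (a' x)) (Fin a) ℂ)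
      (hK : ∑ x, (K x).conjTranspose * K x = 1) (next : ∀ x, LOCC O (a' x) b c) : LOCC O a b c
  | bob {a b c : ℕ} (n : ℕ) (b' : Fin n → ℕ) (K : ∀ x, Matrix (Fin (b' x)) (Fin b) ℂ)
      (hK : ∑ x, (K x).conjTranspose * K x = 1) (next : ∀ x, LOCC O a (b' x) c) : LOCC O a b c
  | charlie {a b c : ℕ} (n : ℕ) (c' : Fin n → ℕ) (K : ∀ x, Matrix (Fin (c' x)) (Fin c) ℂ)
      (hK : ∑ x, (K x).conjTranspose * K x = 1) (next : ∀ x, LOCC O a b (c' x)) : LOCC O a b c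

open Classical in
/-- The probability that the protocol, started in the state `v`, announces `o`. The states along a
run are not renormalized, so that the squared norm of the state at the end of a run is the
probability of that run. -/
def LOCC.prob {O : Type} {a b c : ℕ} : LOCC O a b c → State a b c → O → ℝ
  | .done o', v, o => if o' = o then ‖v‖ ^ 2 else 0
  | .alice _ _ K _ next, v, o => ∑ x, (next x).prob (actA (K x) v) o
  | .bob _ _ K _ next, v, o => ∑ x, (next x).prob (actB (K x) v) o
  | .charlie _ _ K _ next, v, o => ∑ x, (next x).prob (actC (K x) v) o

/-- The measurement in the basis `β` can be implemented by LOCC: up to an arbitrarily small error,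
a finite-round protocol reproduces the probabilities `|⟨β m, χ⟩|²` of all outcomes on all pure
input states `χ`. This includes exact implementations, and those with infinitely many rounds. -/
def LOCCImplementable {n : ℕ} (β : Fin n → Qubits) : Prop :=
  ∀ ε : ℝ, 0 < ε → ∃ P : LOCC (Fin n) 2 2 2, ∀ χ : Qubits, ‖χ‖ = 1 → ∀ m,
    |P.prob χ m - ‖inner ℂ (β m) χ‖ ^ 2| ≤ ε

/-- The measurement in the basis `β` can be implemented by LOCC when the parties also share, one
qubit each, the three-qubit resource state `ψ`, which the protocol may consume. -/
def LOCCImplementableWith (ψ : Qubits) {n : ℕ} (β : Fin n → Qubits) : Prop :=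
  ∀ ε : ℝ, 0 < ε → ∃ P : LOCC (Fin n) (2 * 2) (2 * 2) (2 * 2), ∀ χ : Qubits, ‖χ‖ = 1 → ∀ m,
    |P.prob (tensor χ ψ) m - ‖inner ℂ (β m) χ‖ ^ 2| ≤ ε

end ThreeQubit

end

/-! Only the final probabilities matter, so a finite protocol may be refined until every run is a
rank-one product functional (`LOCC.exists_productFunctional`). Applied to `χ ⊗ ψ`, such a functional
pairs `χ` with `(A ⊗ B ⊗ C) ψ`, where `A`, `B`, `C` are its coefficient vectors read as matrices
(`productFunctional_tensor`). The total weight of the runs equals the dimension, whatever the error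
and the number of rounds (`sum_weight_eq`). Compactness then turns approximate implementability into
an exact statement (`exists_localAct_dual`): for every `m`, some `(A ⊗ B ⊗ C) ψ` is a nonzero
multiple of the conjugate of the `m`-th basis state.

One resource cannot serve both a GHZ-type and a W-type state. Cayley's hyperdeterminant is
multiplied by `(det A * det B * det C) ^ 2` under local operators. It is nonzero on the first state,
so `hyperdet ψ ≠ 0`. It vanishes on the W state, which only invertible operators can produce
(`det_mul_det_mul_det_ne_zero`), so `hyperdet ψ = 0`. LOCC without a resource is covered by taking
`ψ = |000⟩`, whose local transforms are the product vectors. -/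

noncomputable section

namespace ThreeQubit

/-! ### Refinement of LOCC protocols into product functionals -/

/-- The value at `v` of the product functional with coefficients `α`, `β`, `γ`. -/
def productFunctional {a b c : ℕ} (α : Fin a → ℂ) (β : Fin b → ℂ) (γ : Fin c → ℂ)
    (v : State a b c) : ℂ :=
  ∑ i, ∑ j, ∑ k, α i * β j * γ k * v (i, j, k)

theorem sum_rotate {X J K M : Type*} [Fintype X] [Fintype J] [Fintype K] [AddCommMonoid M]
    (F : X → J → K → M) : ∑ x, ∑ j, ∑ k, F x j k = ∑ j, ∑ k, ∑ x, F x j k := by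
  rw [Finset.sum_comm]
  exact Finset.sum_congr rfl fun j _ => Finset.sum_comm

theorem productFunctional_actA {a b c a' : ℕ} (K : Matrix (Fin a') (Fin a) ℂ) (α : Fin a' → ℂ)
    (β : Fin b → ℂ) (γ : Fin c → ℂ) (v : State a b c) :
    productFunctional α β γ (actA K v) =
      productFunctional (fun i => ∑ i', α i' * K i' i) β γ v := by
  simp only [productFunctional, actA, Finset.mul_sum, Finset.sum_mul]
  have h : ∀ (F : Fin a' → Fin b → Fin c → Fin a → ℂ),
      ∑ x, ∑ j, ∑ k, ∑ i, F x j k i = ∑ i, ∑ j, ∑ k, ∑ x, F x j k i := by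
    intro F
    simp_rw [sum_rotate (X := Fin a'), Finset.sum_comm (s := (Finset.univ : Finset (Fin a')))]
    exact (sum_rotate fun i j k => ∑ x, F x j k i).symm
  rw [h]
  refine Finset.sum_congr rfl fun i _ => Finset.sum_congr rfl fun j _ =>
    Finset.sum_congr rfl fun k _ => Finset.sum_congr rfl fun x _ => ?_
  ring

theorem productFunctional_actB {a b c b' : ℕ} (K : Matrix (Fin b') (Fin b) ℂ) (α : Fin a → ℂ)
    (β : Fin b' → ℂ) (γ : Fin c → ℂ) (v : State a b c) :
    productFunctional α β γ (actB K v) =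
      productFunctional α (fun j => ∑ j', β j' * K j' j) γ v := by
  simp only [productFunctional, actB, Finset.mul_sum, Finset.sum_mul]
  refine Finset.sum_congr rfl fun i _ => ?_
  have h : ∀ (F : Fin b' → Fin c → Fin b → ℂ),
      ∑ x, ∑ k, ∑ j, F x k j = ∑ j, ∑ k, ∑ x, F x k j := by
    intro F
    rw [Finset.sum_comm]
    simp_rw [Finset.sum_comm (s := (Finset.univ : Finset (Fin b')))]
    rw [Finset.sum_comm]
  rw [h]
  refine Finset.sum_congr rfl fun j _ =>
    Finset.sum_congr rfl fun k _ => Finset.sum_congr rfl fun x _ => ?_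
  ring

theorem productFunctional_actC {a b c c' : ℕ} (K : Matrix (Fin c') (Fin c) ℂ) (α : Fin a → ℂ)
    (β : Fin b → ℂ) (γ : Fin c' → ℂ) (v : State a b c) :
    productFunctional α β γ (actC K v) =
      productFunctional α β (fun k => ∑ k', γ k' * K k' k) v := by
  simp only [productFunctional, actC, Finset.mul_sum, Finset.sum_mul]
  refine Finset.sum_congr rfl fun i _ => Finset.sum_congr rfl fun j _ => ?_
  rw [Finset.sum_comm]
  refine Finset.sum_congr rfl fun j _ => Finset.sum_congr rfl fun x _ => ?_
  ring

theorem productFunctional_single {a b c : ℕ} (i : Fin a) (j : Fin b) (k : Fin c)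
    (v : State a b c) :
    productFunctional (Pi.single i 1) (Pi.single j 1) (Pi.single k 1) v = v (i, j, k) := by
  simp [productFunctional, Pi.single_apply]

theorem productFunctional_basis {a b c : ℕ} (α : Fin a → ℂ) (β : Fin b → ℂ) (γ : Fin c → ℂ)
    (i : Fin a) (j : Fin b) (k : Fin c) :
    productFunctional α β γ (EuclideanSpace.single (i, j, k) 1) = α i * β j * γ k := by
  simp only [productFunctional, PiLp.single_apply, Prod.mk.injEq, mul_ite, mul_one, mul_zero]
  rw [Finset.sum_eq_single i, Finset.sum_eq_single j, Finset.sum_eq_single k] <;>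
    simp +contextual

theorem norm_sq_eq_sum {a b c : ℕ} (v : State a b c) :
    ‖v‖ ^ 2 = ∑ i, ∑ j, ∑ k, ‖v (i, j, k)‖ ^ 2 := by
  simp [EuclideanSpace.norm_sq_eq, Fintype.sum_prod_type]

/-- Measurement operators preserve the total squared norm. -/
theorem sum_norm_sq_mulVec {n a : ℕ} (a' : Fin n → ℕ) (K : ∀ x, Matrix (Fin (a' x)) (Fin a) ℂ)
    (hK : ∑ x, (K x).conjTranspose * K x = 1) (u : Fin a → ℂ) :
    ∑ x, ∑ i, ‖∑ l, K x i l * u l‖ ^ 2 = ∑ l, ‖u l‖ ^ 2 := by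
  have key : ∀ {p : ℕ} (w : Fin p → ℂ), ((∑ i, ‖w i‖ ^ 2 : ℝ) : ℂ) = star w ⬝ᵥ w := by
    intro p w
    simp [dotProduct, ← Complex.conj_mul']
  have h : ∀ x, star ((K x).mulVec u) ⬝ᵥ (K x).mulVec u =
      star u ⬝ᵥ ((K x).conjTranspose * K x).mulVec u := by
    intro x
    rw [Matrix.star_mulVec, ← Matrix.mulVec_mulVec, Matrix.dotProduct_mulVec,
      Matrix.dotProduct_mulVec, Matrix.dotProduct_mulVec]
  have : ((∑ x, ∑ i, ‖(K x).mulVec u i‖ ^ 2 : ℝ) : ℂ) = ((∑ l, ‖u l‖ ^ 2 : ℝ) : ℂ) := by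
    rw [Complex.ofReal_sum, key u]
    simp_rw [key, h]
    rw [← dotProduct_sum, ← Matrix.sum_mulVec, hK, Matrix.one_mulVec]
  exact_mod_cast this

theorem sum_norm_sq_actA {n a b c : ℕ} (a' : Fin n → ℕ) (K : ∀ x, Matrix (Fin (a' x)) (Fin a) ℂ)
    (hK : ∑ x, (K x).conjTranspose * K x = 1) (v : State a b c) :
    ∑ x, ‖actA (K x) v‖ ^ 2 = ‖v‖ ^ 2 := by
  have h := fun j k => sum_norm_sq_mulVec a' K hK fun i => v (i, j, k)
  simp only [norm_sq_eq_sum, actA]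
  simp_rw [sum_rotate (X := Fin (a' _)), sum_rotate (X := Fin n), h]
  exact (sum_rotate fun l j k => ‖v (l, j, k)‖ ^ 2).symm

theorem sum_norm_sq_actB {n a b c : ℕ} (b' : Fin n → ℕ) (K : ∀ x, Matrix (Fin (b' x)) (Fin b) ℂ)
    (hK : ∑ x, (K x).conjTranspose * K x = 1) (v : State a b c) :
    ∑ x, ‖actB (K x) v‖ ^ 2 = ‖v‖ ^ 2 := by
  have h := fun i k => sum_norm_sq_mulVec b' K hK fun j => v (i, j, k)
  simp only [norm_sq_eq_sum, actB]
  simp_rw [Finset.sum_comm (s := (Finset.univ : Finset (Fin (b' _)))),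
    sum_rotate (X := Fin n), h]
  exact Finset.sum_congr rfl fun i _ => Finset.sum_comm

theorem sum_norm_sq_actC {n a b c : ℕ} (c' : Fin n → ℕ) (K : ∀ x, Matrix (Fin (c' x)) (Fin c) ℂ)
    (hK : ∑ x, (K x).conjTranspose * K x = 1) (v : State a b c) :
    ∑ x, ‖actC (K x) v‖ ^ 2 = ‖v‖ ^ 2 := by
  have h := fun i j => sum_norm_sq_mulVec c' K hK fun k => v (i, j, k)
  simp only [norm_sq_eq_sum, actC]
  rw [sum_rotate]
  simp_rw [h]

/-- The outcome probabilities of an LOCC protocol are sums of squared moduli of product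
functionals, which are complete in the sense that they resolve the squared norm. -/
theorem LOCC.exists_productFunctional {O : Type} {a b c : ℕ} (P : LOCC O a b c) :
    ∃ (ι : Type) (_ : Fintype ι) (α : ι → Fin a → ℂ) (β : ι → Fin b → ℂ) (γ : ι → Fin c → ℂ)
      (out : ι → O),
      (∀ v o, P.prob v o = ∑ r, open Classical in
        if out r = o then ‖productFunctional (α r) (β r) (γ r) v‖ ^ 2 else 0) ∧
      ∀ v, ∑ r, ‖productFunctional (α r) (β r) (γ r) v‖ ^ 2 = ‖v‖ ^ 2 := by
  induction P with
  | @done a b c o =>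
    -- At a leaf the three parties measure in the computational basis and ignore the results; this
    -- splits `‖v‖ ^ 2` into squared coordinates.
    refine ⟨Fin a × Fin b × Fin c, inferInstance, fun r => Pi.single r.1 1,
      fun r => Pi.single r.2.1 1, fun r => Pi.single r.2.2 1, fun _ => o, ?_, ?_⟩
    · intro v o'
      by_cases h : o = o' <;>
        simp [LOCC.prob, h, productFunctional_single, EuclideanSpace.norm_sq_eq]
    · intro v
      simp [productFunctional_single, EuclideanSpace.norm_sq_eq]
  | alice n a' K hK next ih =>
    choose ι hι α β γ out hprob hnorm using ih
    -- A run is a result `x` followed by a run of the continuation; the Kraus operator is absorbed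
    -- into the coefficients of the acting party.
    refine ⟨Σ x, ι x, inferInstance, fun r i => ∑ i', α r.1 r.2 i' * K r.1 i' i,
      fun r => β r.1 r.2, fun r => γ r.1 r.2, fun r => out r.1 r.2, ?_, ?_⟩
    · intro v o
      simp only [LOCC.prob, hprob, Fintype.sum_sigma, productFunctional_actA]
    · intro v
      simp only [Fintype.sum_sigma, ← productFunctional_actA, hnorm, sum_norm_sq_actA a' K hK]
  | bob n b' K hK next ih =>
    choose ι hι α β γ out hprob hnorm using ih
    refine ⟨Σ x, ι x, inferInstance, fun r => α r.1 r.2,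
      fun r j => ∑ j', β r.1 r.2 j' * K r.1 j' j, fun r => γ r.1 r.2, fun r => out r.1 r.2, ?_, ?_⟩
    · intro v o
      simp only [LOCC.prob, hprob, Fintype.sum_sigma, productFunctional_actB]
    · intro v
      simp only [Fintype.sum_sigma, ← productFunctional_actB, hnorm, sum_norm_sq_actB b' K hK]
  | charlie n c' K hK next ih =>
    choose ι hι α β γ out hprob hnorm using ih
    refine ⟨Σ x, ι x, inferInstance, fun r => α r.1 r.2, fun r => β r.1 r.2,
      fun r k => ∑ k', γ r.1 r.2 k' * K r.1 k' k, fun r => out r.1 r.2, ?_, ?_⟩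
    · intro v o
      simp only [LOCC.prob, hprob, Fintype.sum_sigma, productFunctional_actC]
    · intro v
      simp only [Fintype.sum_sigma, ← productFunctional_actC, hnorm, sum_norm_sq_actC c' K hK]

/-- The total weight of a complete family of product functionals is the dimension. -/
theorem sum_weight_eq {ι : Type} [Fintype ι] {a b c : ℕ} {α : ι → Fin a → ℂ}
    {β : ι → Fin b → ℂ} {γ : ι → Fin c → ℂ}
    (h : ∀ v, ∑ r, ‖productFunctional (α r) (β r) (γ r) v‖ ^ 2 = ‖v‖ ^ 2) :
    ∑ r, (∑ i, ‖α r i‖ ^ 2) * (∑ j, ‖β r j‖ ^ 2) * (∑ k, ‖γ r k‖ ^ 2) = a * b * c := by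
  -- This computes a trace: the identity is evaluated on each basis vector and the results are
  -- added.
  have h1 : ∀ t : Fin a × Fin b × Fin c, ∑ r, ‖α r t.1 * β r t.2.1 * γ r t.2.2‖ ^ 2 = 1 := by
    intro t
    have := h (EuclideanSpace.single (t.1, t.2.1, t.2.2) 1)
    simpa only [productFunctional_basis, PiLp.norm_single, norm_one, one_pow] using this
  have h2 := Finset.sum_congr (rfl : (Finset.univ : Finset (Fin a × Fin b × Fin c)) = _)
    fun t _ => h1 t
  rw [Finset.sum_comm] at h2
  simp only [Finset.sum_const, Finset.card_univ, Fintype.card_prod, Fintype.card_fin,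
    nsmul_eq_mul, mul_one, Nat.cast_mul] at h2
  rw [mul_assoc, ← h2]
  refine Finset.sum_congr rfl fun r _ => ?_
  simp only [norm_mul, mul_pow, Fintype.sum_prod_type, ← Finset.mul_sum, ← Finset.sum_mul]

/-! ### Three-qubit resources -/

/-- The bilinear pairing of three-qubit vectors. -/
def dot (g χ : Qubits) : ℂ := ∑ i, ∑ j, ∑ k, g (i, j, k) * χ (i, j, k)

/-- `(A ⊗ B ⊗ C) ψ`. -/
def localAct (A B C : Matrix (Fin 2) (Fin 2) ℂ) (ψ : Qubits) : Qubits :=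
  actA A (actB B (actC C ψ))

/-- A vector of `ℂ^(2 * 2)` as a matrix. -/
def unflatten (α : Fin (2 * 2) → ℂ) : Matrix (Fin 2) (Fin 2) ℂ :=
  fun i j => α (finProdFinEquiv (i, j))

theorem sum_unflatten (α : Fin (2 * 2) → ℂ) :
    ∑ i, ∑ j, ‖unflatten α i j‖ ^ 2 = ∑ i, ‖α i‖ ^ 2 := by
  rw [← finProdFinEquiv.sum_comp, Fintype.sum_prod_type]
  rfl

/-- Each party's index splits into an input part and a resource part. Contracting the resource parts
with `ψ` leaves a functional of `χ` alone. -/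
theorem productFunctional_tensor (α β γ : Fin (2 * 2) → ℂ) (χ ψ : Qubits) :
    productFunctional α β γ (tensor χ ψ) =
      dot (localAct (unflatten α) (unflatten β) (unflatten γ) ψ) χ := by
  have h : ∀ p : Fin 2 × Fin 2, (finProdFinEquiv p).divNat = p.1 ∧
      (finProdFinEquiv p).modNat = p.2 := by
    intro p
    have := finProdFinEquiv.symm_apply_apply p
    rw [finProdFinEquiv_symm_apply] at this
    exact ⟨congrArg Prod.fst this, congrArg Prod.snd this⟩
  simp only [productFunctional, tensor]
  rw [← finProdFinEquiv.sum_comp]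
  simp_rw [← (finProdFinEquiv (m := 2) (n := 2)).sum_comp, h]
  simp only [Fintype.sum_prod_type, Fin.sum_univ_two, dot, localAct, actA, actB, actC, unflatten]
  ring

/-! ### The states -/

theorem one_add_sq_of_cube {ω : ℂ} (hω : ω ^ 3 = 1) (hω' : ω.im ≠ 0) : 1 + ω + ω ^ 2 = 0 := by
  have h1 : ω - 1 ≠ 0 := by
    intro h
    rw [sub_eq_zero.mp h] at hω'
    simp at hω'
  refine (mul_eq_zero.mp ?_).resolve_left h1
  linear_combination hω

theorem conj_of_cube {ω : ℂ} (hω : ω ^ 3 = 1) : (starRingEnd ℂ) ω = ω ^ 2 := by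
  have hn : ‖ω‖ = 1 := Complex.norm_eq_one_of_pow_eq_one hω (by norm_num)
  have h : ω * (starRingEnd ℂ) ω = 1 := by
    rw [Complex.mul_conj', hn]
    norm_num
  linear_combination ω ^ 2 * h - (starRingEnd ℂ) ω * hω

theorem sqrt_cast_sq (n : ℕ) : ((Real.sqrt n : ℝ) : ℂ) ^ 2 = n := by
  rw [← Complex.ofReal_pow, Real.sq_sqrt (Nat.cast_nonneg n), Complex.ofReal_natCast]

theorem sqrt_three_inv_sq : (((Real.sqrt 3 : ℝ) : ℂ)⁻¹) ^ 2 = 1 / 3 := by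
  have := sqrt_cast_sq 3
  push_cast at this
  rw [inv_pow, this, one_div]

theorem sqrt_two_inv_sq : (((Real.sqrt 2 : ℝ) : ℂ)⁻¹) ^ 2 = 1 / 2 := by
  have := sqrt_cast_sq 2
  push_cast at this
  rw [inv_pow, this, one_div]

theorem completedBasis_castSucc (ω : ℂ) (m : Fin 7) :
    completedBasis ω m.castSucc = sevenStates ω m := by
  simp [completedBasis]

theorem completedBasis_last (ω : ℂ) : completedBasis ω (Fin.last 7) = ket 1 1 1 :=
  Fin.snoc_last (α := fun _ => Qubits) _ _

theorem inner_eq_sum (v w : Qubits) :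
    inner ℂ v w = ∑ i, ∑ j, ∑ k, (starRingEnd ℂ) (v (i, j, k)) * w (i, j, k) := by
  simp [PiLp.inner_apply, Fintype.sum_prod_type, mul_comm]

theorem ket_apply (i j k i' j' k' : Fin 2) :
    ket i j k (i', j', k') = if i' = i ∧ j' = j ∧ k' = k then 1 else 0 := by
  simp [ket]

theorem orthonormal_sevenStates {ω : ℂ} (hω : ω ^ 3 = 1) (hω' : ω.im ≠ 0) :
    Orthonormal ℂ (sevenStates ω) := by
  have h1 := one_add_sq_of_cube hω hω'
  have hc := conj_of_cube hω
  have hs := sqrt_three_inv_sq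
  rw [orthonormal_iff_ite]
  intro m n
  rw [inner_eq_sum]
  have hc2 : (starRingEnd ℂ) 2 = 2 := Complex.conj_ofNat 2
  set s : ℂ := ((Real.sqrt 3 : ℝ) : ℂ)⁻¹
  fin_cases m <;> fin_cases n <;>
    simp [Fin.sum_univ_two, ket_apply, sevenStates, hc, hc2] <;>
    -- The entries of the Gram matrix reduce by `s ^ 2 = 1 / 3`, `ω ^ 3 = 1` and `1 + ω + ω ^ 2 =
    -- 0`.
    first
    | ring1
    | linear_combination 3 * hs
    | linear_combination 3 * hs + s ^ 2 * (2 + ω ^ 3) * hω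
    | linear_combination s ^ 2 * h1
    | linear_combination s ^ 2 * h1 + s ^ 2 * ω * hω
    | linear_combination s ^ 2 * h1 + s ^ 2 * (ω + ω ^ 2) * hω

theorem inner_ket_sevenStates (ω : ℂ) (m : Fin 7) :
    inner ℂ (sevenStates ω m) (ket 1 1 1) = 0 := by
  fin_cases m <;> simp [inner_eq_sum, Fin.sum_univ_two, ket_apply, sevenStates]

theorem orthonormal_completedBasis {ω : ℂ} (hω : ω ^ 3 = 1) (hω' : ω.im ≠ 0) :
    Orthonormal ℂ (completedBasis ω) := by
  have h7 := orthonormal_iff_ite.mp (orthonormal_sevenStates hω hω')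
  rw [orthonormal_iff_ite]
  intro m n
  induction m using Fin.lastCases with
  | last =>
    induction n using Fin.lastCases with
    | last => rw [completedBasis_last]; simp [ket]
    | cast n =>
      rw [completedBasis_last, completedBasis_castSucc, ← inner_conj_symm,
        inner_ket_sevenStates, map_zero, if_neg (Fin.castSucc_lt_last n).ne']
  | cast m =>
    induction n using Fin.lastCases with
    | last =>
      rw [completedBasis_last, completedBasis_castSucc, inner_ket_sevenStates,
        if_neg (Fin.castSucc_lt_last m).ne]
    | cast n =>
      rw [completedBasis_castSucc, completedBasis_castSucc, h7]
      simp

theorem span_completedBasis {ω : ℂ} (hω : ω ^ 3 = 1) (hω' : ω.im ≠ 0) :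
    Submodule.span ℂ (Set.range (completedBasis ω)) = ⊤ :=
  (orthonormal_completedBasis hω hω').linearIndependent.span_eq_top_of_card_eq_finrank'
    (by simp [finrank_euclideanSpace])

theorem orthogonal_span_sevenStates {ω : ℂ} (hω : ω ^ 3 = 1) (hω' : ω.im ≠ 0) :
    (Submodule.span ℂ (Set.range (sevenStates ω)))ᗮ = Submodule.span ℂ {ket 1 1 1} := by
  apply le_antisymm
  · intro v hv
    have h7 : ∀ m, inner ℂ (sevenStates ω m) v = 0 := fun m =>
      (Submodule.mem_orthogonal _ _).mp hv _ (Submodule.subset_span ⟨m, rfl⟩)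
    let b := OrthonormalBasis.mk (orthonormal_completedBasis hω hω') (span_completedBasis hω hω').ge
    -- In the expansion of `v` in the completed basis only the coefficient of `|111⟩` survives.
    have hb := b.sum_repr' v
    simp only [b, OrthonormalBasis.coe_mk, Fin.sum_univ_castSucc (n := 7), completedBasis_castSucc,
      completedBasis_last, h7, zero_smul, Finset.sum_const_zero, zero_add] at hb
    exact Submodule.mem_span_singleton.mpr ⟨_, hb⟩
  · rw [Submodule.span_singleton_le_iff_mem, Submodule.mem_orthogonal]
    intro u hu
    induction hu using Submodule.span_induction with
    | mem x hx =>
      obtain ⟨m, rfl⟩ := hx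
      exact inner_ket_sevenStates ω m
    | zero => simp
    | add x y _ _ hx hy => rw [inner_add_left, hx, hy, add_zero]
    | smul a x _ hx => rw [inner_smul_left, hx, mul_zero]

/-! ### Entanglement -/

theorem IsFullyProduct.isProductAcross {v : Qubits} (h : IsFullyProduct v) (cut : Cut) :
    IsProductAcross cut v := by
  obtain ⟨x, y, z, h⟩ := h
  cases cut
  · exact ⟨x, fun p => y p.1 * z p.2, fun i j k => by rw [h]; ring⟩
  · exact ⟨y, fun p => x p.1 * z p.2, fun i j k => by rw [h]; ring⟩
  · exact ⟨z, fun p => x p.1 * y p.2, fun i j k => by rw [h]; ring⟩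

/-- For each cut, one 2×2 minor of the coefficient matrix has exactly one nonzero term on each
state: one diagonal for the GHZ type, the other for the W type. -/
theorem not_isProductAcross_sevenStates {ω : ℂ} (hω : ω ^ 3 = 1) (cut : Cut) (m : Fin 7) :
    ¬ IsProductAcross cut (sevenStates ω m) := by
  have h0 : ω ≠ 0 := by rintro rfl; norm_num at hω
  cases cut
  · rintro ⟨x, y, h⟩
    have e1 : sevenStates ω m (0, 0, 0) * sevenStates ω m (1, 0, 1) =
        sevenStates ω m (0, 0, 1) * sevenStates ω m (1, 0, 0) := by
      simp only [h]; ring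
    fin_cases m <;> simp [sevenStates, ket_apply, h0] at e1
  · rintro ⟨x, y, h⟩
    have e1 : sevenStates ω m (0, 0, 0) * sevenStates ω m (0, 1, 1) =
        sevenStates ω m (0, 0, 1) * sevenStates ω m (0, 1, 0) := by
      simp only [h]; ring
    fin_cases m <;> simp [sevenStates, ket_apply, h0] at e1
  · rintro ⟨x, y, h⟩
    have e1 : sevenStates ω m (0, 0, 0) * sevenStates ω m (0, 1, 1) =
        sevenStates ω m (0, 0, 1) * sevenStates ω m (0, 1, 0) := by
      simp only [h]; ring
    fin_cases m <;> simp [sevenStates, ket_apply, h0] at e1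

theorem isFullyProduct_of_mem_span {v : Qubits} (hv : v ∈ Submodule.span ℂ {ket 1 1 1}) :
    IsFullyProduct v := by
  obtain ⟨a, rfl⟩ := Submodule.mem_span_singleton.mp hv
  refine ⟨![0, a], ![0, 1], ![0, 1], fun i j k => ?_⟩
  fin_cases i <;> fin_cases j <;> fin_cases k <;> simp [ket_apply]

theorem isUEB_sevenStates {ω : ℂ} (hω : ω ^ 3 = 1) (hω' : ω.im ≠ 0) (IsProd : Qubits → Prop)
    (hent : ∀ m, ¬ IsProd (sevenStates ω m)) (hprod : ∀ v, IsFullyProduct v → IsProd v) :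
    IsUEB IsProd (sevenStates ω) := by
  refine ⟨orthonormal_sevenStates hω hω', hent, ?_, ?_⟩
  -- If the span were everything, its complement would be zero, yet it contains `|111⟩`.
  · intro h
    have h1 := orthogonal_span_sevenStates hω hω'
    rw [h, Submodule.top_orthogonal_eq_bot] at h1
    have h2 : ket 1 1 1 ∈ (⊥ : Submodule ℂ Qubits) := h1 ▸ Submodule.mem_span_singleton_self _
    simp [ket] at h2
  · intro v hv
    rw [orthogonal_span_sevenStates hω hω'] at hv
    exact hprod v (isFullyProduct_of_mem_span hv)

/-! ### Entanglement classes -/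

/-- The matrix `diag (1, z)`. -/
def phase (z : ℂ) : Matrix (Fin 2) (Fin 2) ℂ := !![1, 0; 0, z]

/-- The Hadamard matrix. -/
def hadamard : Matrix (Fin 2) (Fin 2) ℂ := (1 / (Real.sqrt 2 : ℂ)) • !![1, 1; 1, -1]

theorem isUnit_phase {z : ℂ} (hz : z ≠ 0) : IsUnit (phase z) := by
  rw [Matrix.isUnit_iff_isUnit_det, isUnit_iff_ne_zero]
  simpa [phase, Matrix.det_fin_two] using hz

theorem isUnit_phase_mul_hadamard {z : ℂ} (hz : z ≠ 0) : IsUnit (phase z * hadamard) := by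
  refine (isUnit_phase hz).mul ?_
  rw [Matrix.isUnit_iff_isUnit_det, isUnit_iff_ne_zero]
  simp only [hadamard, one_div, Matrix.det_smul, Fintype.card_fin, sqrt_two_inv_sq,
    Matrix.det_fin_two_of]
  norm_num

/-- Three Hadamards map the GHZ state to the uniform superposition of even-parity kets, the first
state. A phase flip by one party gives each of the other three. -/
theorem isGHZClass_sevenStates (ω : ℂ) (m : Fin 7) (hm : m.val < 4) :
    IsGHZClass (sevenStates ω m) := by
  have hu : ∀ p q r : ℂ, p ≠ 0 → q ≠ 0 → r ≠ 0 →
      IsGHZClass (actA (phase p * hadamard) (actB (phase q * hadamard)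
        (actC (phase r * hadamard) ghz))) := fun p q r hp hq hr =>
    ⟨_, _, _, isUnit_phase_mul_hadamard hp, isUnit_phase_mul_hadamard hq,
      isUnit_phase_mul_hadamard hr, rfl⟩
  have hs := sqrt_two_inv_sq
  -- The fourth power collects three Hadamard factors and the normalization of the GHZ state.
  have hs4 : (((Real.sqrt 2 : ℝ) : ℂ)⁻¹) ^ 4 = 1 / 4 := by
    linear_combination ((((Real.sqrt 2 : ℝ) : ℂ)⁻¹) ^ 2 + 1 / 2) * hs
  have hv : ∀ p q r : ℂ, sevenStates ω m = actA (phase p * hadamard) (actB (phase q * hadamard)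
        (actC (phase r * hadamard) ghz)) → p ≠ 0 → q ≠ 0 → r ≠ 0 →
      IsGHZClass (sevenStates ω m) := fun p q r h hp hq hr => h ▸ hu p q r hp hq hr
  have hcases : m = 0 ∨ m = 1 ∨ m = 2 ∨ m = 3 := by omega
  rcases hcases with rfl | rfl | rfl | rfl
  · refine hv 1 1 1 ?_ (by simp) (by simp) (by simp)
    ext ⟨i, j, k⟩
    fin_cases i <;> fin_cases j <;> fin_cases k <;>
      simp [sevenStates, ket_apply, actA, actB, actC, phase, hadamard, ghz, Fin.sum_univ_two] <;>
      linear_combination (-2) * hs4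
  · refine hv (-1) 1 1 ?_ (by simp) (by simp) (by simp)
    ext ⟨i, j, k⟩
    fin_cases i <;> fin_cases j <;> fin_cases k <;>
      simp [sevenStates, ket_apply, actA, actB, actC, phase, hadamard, ghz, Fin.sum_univ_two] <;>
      first | linear_combination (-2) * hs4 | linear_combination 2 * hs4
  · refine hv 1 (-1) 1 ?_ (by simp) (by simp) (by simp)
    ext ⟨i, j, k⟩
    fin_cases i <;> fin_cases j <;> fin_cases k <;>
      simp [sevenStates, ket_apply, actA, actB, actC, phase, hadamard, ghz, Fin.sum_univ_two] <;>
      first | linear_combination (-2) * hs4 | linear_combination 2 * hs4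
  · refine hv 1 1 (-1) ?_ (by simp) (by simp) (by simp)
    ext ⟨i, j, k⟩
    fin_cases i <;> fin_cases j <;> fin_cases k <;>
      simp [sevenStates, ket_apply, actA, actB, actC, phase, hadamard, ghz, Fin.sum_univ_two] <;>
      first | linear_combination (-2) * hs4 | linear_combination 2 * hs4

theorem isWClass_sevenStates {ω : ℂ} (hω : ω ^ 3 = 1) (m : Fin 7) (hm : 4 ≤ m.val) :
    IsWClass (sevenStates ω m) := by
  have h0 : ω ≠ 0 := by rintro rfl; norm_num at hω
  have hv : ∀ p q : ℂ, sevenStates ω m = actA (phase p) (actB (phase q) (actC (phase 1) wState)) →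
      p ≠ 0 → q ≠ 0 → IsWClass (sevenStates ω m) := fun p q h hp hq =>
    ⟨_, _, _, isUnit_phase hp, isUnit_phase hq, isUnit_phase one_ne_zero, h⟩
  have hcases : m = 4 ∨ m = 5 ∨ m = 6 := by omega
  rcases hcases with rfl | rfl | rfl
  · refine hv 1 1 ?_ one_ne_zero one_ne_zero
    ext ⟨i, j, k⟩
    fin_cases i <;> fin_cases j <;> fin_cases k <;>
      simp [sevenStates, ket_apply, actA, actB, actC, phase, wState, Fin.sum_univ_two]
  · refine hv (ω ^ 2) ω ?_ (pow_ne_zero 2 h0) h0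
    ext ⟨i, j, k⟩
    fin_cases i <;> fin_cases j <;> fin_cases k <;>
      simp [sevenStates, ket_apply, actA, actB, actC, phase, wState, Fin.sum_univ_two] <;>
      ring
  · refine hv ω (ω ^ 2) ?_ h0 (pow_ne_zero 2 h0)
    ext ⟨i, j, k⟩
    fin_cases i <;> fin_cases j <;> fin_cases k <;>
      simp [sevenStates, ket_apply, actA, actB, actC, phase, wState, Fin.sum_univ_two] <;>
      ring

/-! ### Cayley's hyperdeterminant -/

/-- Cayley's hyperdeterminant of a three-qubit vector. -/
def hyperdet (v : Qubits) : ℂ :=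
  (v (0, 0, 0) * v (1, 1, 1) - v (0, 0, 1) * v (1, 1, 0) - v (0, 1, 0) * v (1, 0, 1) +
      v (1, 0, 0) * v (0, 1, 1)) ^ 2 -
    4 * (v (0, 0, 0) * v (0, 1, 1) - v (0, 0, 1) * v (0, 1, 0)) *
      (v (1, 0, 0) * v (1, 1, 1) - v (1, 0, 1) * v (1, 1, 0))

theorem hyperdet_actA (A : Matrix (Fin 2) (Fin 2) ℂ) (v : Qubits) :
    hyperdet (actA A v) = A.det ^ 2 * hyperdet v := by
  simp only [hyperdet, actA, Fin.sum_univ_two, Matrix.det_fin_two]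
  ring

theorem hyperdet_actB (A : Matrix (Fin 2) (Fin 2) ℂ) (v : Qubits) :
    hyperdet (actB A v) = A.det ^ 2 * hyperdet v := by
  simp only [hyperdet, actB, Fin.sum_univ_two, Matrix.det_fin_two]
  ring

theorem hyperdet_actC (A : Matrix (Fin 2) (Fin 2) ℂ) (v : Qubits) :
    hyperdet (actC A v) = A.det ^ 2 * hyperdet v := by
  simp only [hyperdet, actC, Fin.sum_univ_two, Matrix.det_fin_two]
  ring

/-- This is a polynomial identity, so singular operators are included. -/
theorem hyperdet_localAct (A B C : Matrix (Fin 2) (Fin 2) ℂ) (ψ : Qubits) :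
    hyperdet (localAct A B C ψ) = (A.det * B.det * C.det) ^ 2 * hyperdet ψ := by
  rw [localAct, hyperdet_actA, hyperdet_actB, hyperdet_actC]
  ring

theorem hyperdet_smul (c : ℂ) (v : Qubits) : hyperdet (c • v) = c ^ 4 * hyperdet v := by
  simp only [hyperdet, PiLp.smul_apply, smul_eq_mul]
  ring

/-- The rows of a singular matrix are linearly dependent. -/
theorem exists_vecMul_eq_zero {A : Matrix (Fin 2) (Fin 2) ℂ} (hA : A.det = 0) :
    ∃ p q : ℂ, (p ≠ 0 ∨ q ≠ 0) ∧ ∀ i, p * A 0 i + q * A 1 i = 0 := by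
  obtain ⟨w, hw, h⟩ := Matrix.exists_vecMul_eq_zero_iff.mpr hA
  refine ⟨w 0, w 1, ?_, fun i => ?_⟩
  · by_contra! h2
    exact hw (by ext i; fin_cases i <;> simp [h2.1, h2.2])
  · simpa [Matrix.vecMul, dotProduct, Fin.sum_univ_two] using congrFun h i

/-- Local operators that produce the W state are invertible. -/
theorem det_mul_det_mul_det_ne_zero {A B C : Matrix (Fin 2) (Fin 2) ℂ} {ψ : Qubits} {c : ℂ}
    (hc : c ≠ 0) (h : localAct A B C ψ = c • wState) : A.det * B.det * C.det ≠ 0 := by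
  have e := fun i j k => congrArg (fun v : Qubits => v (i, j, k)) h
  have cA : ∀ i j k, c • wState (i, j, k) = ∑ l, A i l * (actB B (actC C ψ)) (l, j, k) :=
    fun i j k => (e i j k).symm
  -- Operators of different parties commute, so each of the three can be made the outermost one.
  have comm : localAct A B C ψ = actB B (actA A (actC C ψ)) ∧
      localAct A B C ψ = actC C (actA A (actB B ψ)) := by
    constructor <;> ext ⟨i, j, k⟩ <;>
      simp only [localAct, actA, actB, actC, Fin.sum_univ_two] <;> ring
  have cB : ∀ i j k, c • wState (i, j, k) = ∑ l, B j l * (actA A (actC C ψ)) (i, l, k) :=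
    fun i j k => by rw [← PiLp.smul_apply, ← h, comm.1]; rfl
  have cC : ∀ i j k, c • wState (i, j, k) = ∑ l, C k l * (actA A (actB B ψ)) (i, j, l) :=
    fun i j k => by rw [← PiLp.smul_apply, ← h, comm.2]; rfl
  refine mul_ne_zero (mul_ne_zero ?_ ?_) ?_ <;> intro hd <;>
    obtain ⟨p, q, hpq, hz⟩ := exists_vecMul_eq_zero hd <;>
    rw [Fin.forall_fin_two] at hz
  -- A relation between the rows of `A` carries over to the two slices of the W state. The entries
  -- `(0, 0)` and `(0, 1)` of the slices force `q = 0` and `p = 0`; the other parties are treated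
  -- alike.
  · have r : ∀ j k, p * (c • wState (0, j, k)) + q * (c • wState (1, j, k)) = 0 := by
      intro j k
      rw [cA, cA, Fin.sum_univ_two, Fin.sum_univ_two]
      linear_combination (actB B (actC C ψ)) (0, j, k) * hz.1 +
        (actB B (actC C ψ)) (1, j, k) * hz.2
    have r0 := r 0 0
    have r1 := r 0 1
    simp [wState, ket_apply, hc] at r0 r1
    simp [r0, r1] at hpq
  · have r : ∀ j k, p * (c • wState (j, 0, k)) + q * (c • wState (j, 1, k)) = 0 := by
      intro j k
      rw [cB, cB, Fin.sum_univ_two, Fin.sum_univ_two]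
      linear_combination (actA A (actC C ψ)) (j, 0, k) * hz.1 +
        (actA A (actC C ψ)) (j, 1, k) * hz.2
    have r0 := r 0 0
    have r1 := r 0 1
    simp [wState, ket_apply, hc] at r0 r1
    simp [r0, r1] at hpq
  · have r : ∀ j k, p * (c • wState (j, k, 0)) + q * (c • wState (j, k, 1)) = 0 := by
      intro j k
      rw [cC, cC, Fin.sum_univ_two, Fin.sum_univ_two]
      linear_combination (actA A (actB B ψ)) (j, k, 0) * hz.1 +
        (actA A (actB B ψ)) (j, k, 1) * hz.2
    have r0 := r 0 0
    have r1 := r 0 1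
    simp [wState, ket_apply, hc] at r0 r1
    simp [r0, r1] at hpq

/-! ### Compactness -/

/-- On a compact set, a continuous function that is nonpositive on the zero set of a nonnegative
continuous function `h` is dominated by a multiple of `h` up to an arbitrarily small error. -/
theorem exists_le_mul_add {X : Type*} [TopologicalSpace X] {s : Set X} (hs : IsCompact s)
    {f h : X → ℝ} (hf : Continuous f) (hh : Continuous h) (h0 : ∀ x, 0 ≤ h x)
    (hfh : ∀ x ∈ s, h x = 0 → f x ≤ 0) {η : ℝ} (hη : 0 < η) :
    ∃ L : ℝ, 0 ≤ L ∧ ∀ x ∈ s, f x ≤ L * h x + η := by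
  -- Only the compact part where `f ≥ η` matters. There `h` is bounded away from zero, and `L` is
  -- the maximum of `f` over the minimum of `h`.
  have ht : IsCompact (s ∩ {x | η ≤ f x}) := hs.inter_right (isClosed_le continuous_const hf)
  rcases (s ∩ {x | η ≤ f x}).eq_empty_or_nonempty with he | hne
  · refine ⟨0, le_rfl, fun x hx => ?_⟩
    by_contra! hlt
    exact Set.eq_empty_iff_forall_notMem.mp he x ⟨hx, by simp only [Set.mem_ofPred_eq]; linarith⟩
  · obtain ⟨x₁, ⟨h₁s, h₁⟩, hmin⟩ := ht.exists_isMinOn hne hh.continuousOn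
    obtain ⟨x₂, ⟨-, h₂⟩, hmax⟩ := ht.exists_isMaxOn hne hf.continuousOn
    simp only [Set.mem_ofPred_eq] at h₁ h₂
    have hd : 0 < h x₁ := (h0 x₁).lt_of_ne fun he => by linarith [hfh x₁ h₁s he.symm]
    have hF : 0 ≤ f x₂ / h x₁ := div_nonneg (by linarith) hd.le
    refine ⟨f x₂ / h x₁, hF, fun x hx => ?_⟩
    by_cases hxη : η ≤ f x
    · have h3 : f x ≤ f x₂ := hmax ⟨hx, hxη⟩
      have h4 : h x₁ ≤ h x := hmin ⟨hx, hxη⟩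
      have h5 : f x₂ ≤ f x₂ / h x₁ * h x := by
        calc f x₂ = f x₂ / h x₁ * h x₁ := (div_mul_cancel₀ _ hd.ne').symm
          _ ≤ _ := mul_le_mul_of_nonneg_left h4 hF
      linarith
    · have := mul_nonneg hF (h0 x)
      linarith [not_le.mp hxη]

/-- The squared Frobenius norm. -/
def weight (A : Matrix (Fin 2) (Fin 2) ℂ) : ℝ := ∑ i, ∑ j, ‖A i j‖ ^ 2

theorem weight_nonneg (A : Matrix (Fin 2) (Fin 2) ℂ) : 0 ≤ weight A :=
  Finset.sum_nonneg fun _ _ => Finset.sum_nonneg fun _ _ => sq_nonneg _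

theorem norm_sq_le_weight (A : Matrix (Fin 2) (Fin 2) ℂ) (i j : Fin 2) : ‖A i j‖ ^ 2 ≤ weight A :=
  (Finset.single_le_sum (f := fun j => ‖A i j‖ ^ 2) (fun _ _ => sq_nonneg _)
    (Finset.mem_univ j)).trans
    (Finset.single_le_sum (f := fun i => ∑ j, ‖A i j‖ ^ 2)
      (fun _ _ => Finset.sum_nonneg fun _ _ => sq_nonneg _) (Finset.mem_univ i))

/-- The matrices with entries of modulus at most one. -/
def unitBox : Set (Matrix (Fin 2) (Fin 2) ℂ) := {A | ∀ i j, ‖A i j‖ ≤ 1}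

theorem isCompact_unitBox : IsCompact unitBox := by
  have h : IsCompact (Set.univ.pi fun _ : Fin 2 => Set.univ.pi fun _ : Fin 2 =>
      Metric.closedBall (0 : ℂ) 1) :=
    isCompact_univ_pi fun _ => isCompact_univ_pi fun _ => isCompact_closedBall 0 1
  have he : unitBox = Set.univ.pi fun _ : Fin 2 => Set.univ.pi fun _ : Fin 2 =>
      Metric.closedBall (0 : ℂ) 1 := by
    refine Set.ext fun A => ⟨fun h i _ j _ => mem_closedBall_zero_iff.mpr (h i j),
      fun h i j => mem_closedBall_zero_iff.mp (h i trivial j trivial)⟩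
  exact he ▸ h

theorem exists_smul_mem_unitBox (A : Matrix (Fin 2) (Fin 2) ℂ) :
    ∃ (c : ℂ) (A' : Matrix (Fin 2) (Fin 2) ℂ), A' ∈ unitBox ∧ A = c • A' ∧ ‖c‖ ^ 2 = weight A := by
  have hw := weight_nonneg A
  have hn : ‖((Real.sqrt (weight A) : ℝ) : ℂ)‖ ^ 2 = weight A := by
    rw [Complex.norm_real, Real.norm_eq_abs, sq_abs, Real.sq_sqrt hw]
  rcases eq_or_lt_of_le hw with h0 | hpos
  · refine ⟨0, 0, by simp [unitBox], ?_, by simp [← h0]⟩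
    ext i j
    have := norm_sq_le_weight A i j
    rw [← h0] at this
    simpa using le_antisymm this (sq_nonneg _)
  · have hs : ((Real.sqrt (weight A) : ℝ) : ℂ) ≠ 0 := by
      simpa using (Real.sqrt_pos.mpr hpos).ne'
    refine ⟨_, ((Real.sqrt (weight A) : ℝ) : ℂ)⁻¹ • A, fun i j => ?_, ?_, hn⟩
    · rw [← sq_le_one_iff₀ (norm_nonneg _), Matrix.smul_apply, norm_smul, mul_pow, norm_inv,
        inv_pow, hn, inv_mul_le_one₀ hpos]
      exact norm_sq_le_weight A i j
    · rw [smul_smul, mul_inv_cancel₀ hs, one_smul]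

theorem localAct_smul (p q r : ℂ) (A B C : Matrix (Fin 2) (Fin 2) ℂ) (ψ : Qubits) :
    localAct (p • A) (q • B) (r • C) ψ = (p * q * r) • localAct A B C ψ := by
  ext ⟨i, j, k⟩
  simp only [localAct, actA, actB, actC, Fin.sum_univ_two, Matrix.smul_apply, PiLp.smul_apply,
    smul_eq_mul]
  ring

theorem dot_smul_left (c : ℂ) (g χ : Qubits) : dot (c • g) χ = c * dot g χ := by
  simp only [dot, PiLp.smul_apply, smul_eq_mul, Finset.mul_sum, mul_assoc]

theorem continuous_dot_localAct (ψ χ : Qubits) :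
    Continuous fun M : Matrix (Fin 2) (Fin 2) ℂ × Matrix (Fin 2) (Fin 2) ℂ ×
      Matrix (Fin 2) (Fin 2) ℂ => dot (localAct M.1 M.2.1 M.2.2 ψ) χ := by
  simp only [dot, localAct, actA, actB, actC]
  have h1 : ∀ i j, Continuous fun M : Matrix (Fin 2) (Fin 2) ℂ × Matrix (Fin 2) (Fin 2) ℂ ×
      Matrix (Fin 2) (Fin 2) ℂ => M.1 i j := fun i j => continuous_fst.matrix_elem i j
  have h2 : ∀ i j, Continuous fun M : Matrix (Fin 2) (Fin 2) ℂ × Matrix (Fin 2) (Fin 2) ℂ ×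
      Matrix (Fin 2) (Fin 2) ℂ => M.2.1 i j :=
    fun i j => (continuous_fst.comp continuous_snd).matrix_elem i j
  have h3 : ∀ i j, Continuous fun M : Matrix (Fin 2) (Fin 2) ℂ × Matrix (Fin 2) (Fin 2) ℂ ×
      Matrix (Fin 2) (Fin 2) ℂ => M.2.2 i j :=
    fun i j => (continuous_snd.comp continuous_snd).matrix_elem i j
  fun_prop

/-- If no local transform of `ψ` is dual to `b m`, then the overlaps of the local transforms of `ψ`
with `b m` are controlled by the overlaps with the other vectors. -/
theorem exists_overlap_bound {n : ℕ} (ψ : Qubits) (b : Fin n → Qubits) (m : Fin n)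
    (hm : ∀ A B C, (∀ k, k ≠ m → dot (localAct A B C ψ) (b k) = 0) →
      dot (localAct A B C ψ) (b m) = 0) {η : ℝ} (hη : 0 < η) :
    ∃ L : ℝ, 0 ≤ L ∧ ∀ A B C, ‖dot (localAct A B C ψ) (b m)‖ ^ 2 ≤
      L * ∑ k with k ≠ m, ‖dot (localAct A B C ψ) (b k)‖ ^ 2 +
        η * (weight A * weight B * weight C) := by
  obtain ⟨L, hL, hbound⟩ := exists_le_mul_add
    (isCompact_unitBox.prod (isCompact_unitBox.prod isCompact_unitBox))
    (f := fun M => ‖dot (localAct M.1 M.2.1 M.2.2 ψ) (b m)‖ ^ 2)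
    (h := fun M => ∑ k with k ≠ m, ‖dot (localAct M.1 M.2.1 M.2.2 ψ) (b k)‖ ^ 2)
    ((continuous_dot_localAct ψ _).norm.pow 2)
    (continuous_finsetSum _ fun k _ => (continuous_dot_localAct ψ _).norm.pow 2)
    (fun _ => Finset.sum_nonneg fun _ _ => sq_nonneg _)
    (fun M _ h0 => by
      rw [Finset.sum_eq_zero_iff_of_nonneg fun _ _ => sq_nonneg _] at h0
      have := hm M.1 M.2.1 M.2.2 fun k hk => by
        simpa using h0 k (Finset.mem_filter.mpr ⟨Finset.mem_univ _, hk⟩)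
      simp [this]) hη
  refine ⟨L, hL, fun A B C => ?_⟩
  -- Both sides scale by `‖p‖ ^ 2 * ‖q‖ ^ 2 * ‖r‖ ^ 2`, so the bound on the unit box extends to all
  -- matrices.
  obtain ⟨p, A', hA', hA, hp⟩ := exists_smul_mem_unitBox A
  obtain ⟨q, B', hB', hB, hq⟩ := exists_smul_mem_unitBox B
  obtain ⟨r, C', hC', hC, hr⟩ := exists_smul_mem_unitBox C
  have h1 := hbound (A', B', C') ⟨hA', hB', hC'⟩
  rw [← hp, ← hq, ← hr, hA, hB, hC]
  simp only [localAct_smul, dot_smul_left, norm_mul, mul_pow, ← Finset.mul_sum]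
  have h2 := mul_le_mul_of_nonneg_left h1 (by positivity : 0 ≤ ‖p‖ ^ 2 * ‖q‖ ^ 2 * ‖r‖ ^ 2)
  refine h2.trans_eq ?_
  ring

/-! ### Implementability forces exact local transformations -/

/-- If local transforms of `ψ` of bounded total weight approximately implement the measurement
dual to `b`, then some local transform of `ψ` is dual to `b m`. -/
theorem exists_localAct_dual {n : ℕ} (ψ : Qubits) (b : Fin n → Qubits) (m : Fin n) (T : ℝ)
    (h : ∀ ε : ℝ, 0 < ε → ∃ (ι : Type) (_ : Fintype ι)
      (A B C : ι → Matrix (Fin 2) (Fin 2) ℂ) (out : ι → Fin n),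
      (∑ r, weight (A r) * weight (B r) * weight (C r) = T) ∧
      ∀ k, |(∑ r, open Classical in if out r = m then
        ‖dot (localAct (A r) (B r) (C r) ψ) (b k)‖ ^ 2 else 0) - if k = m then 1 else 0| ≤ ε) :
    ∃ A B C, (∀ k, k ≠ m → dot (localAct A B C ψ) (b k) = 0) ∧
      dot (localAct A B C ψ) (b m) ≠ 0 := by
  classical
  by_contra! hcon
  have hT : 0 < |T| + 1 := by positivity
  -- The order of choices matters: `η` depends on `T` only, `L` on `η`, and `ε` on `L`. Summing the
  -- bound over the runs announcing `m` then gives `1 - ε ≤ L * (n * ε) + η * T ≤ 1 / 2`, against `ε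
  -- ≤ 1 / 4`.
  obtain ⟨L, hL, hb⟩ := exists_overlap_bound ψ b m hcon (η := 1 / (4 * (|T| + 1))) (by positivity)
  obtain ⟨ι, _, A, B, C, out, hw, hε⟩ := h (1 / (4 * (L * n + 1))) (by positivity)
  set ε := 1 / (4 * (L * n + 1)) with hεdef
  set η := 1 / (4 * (|T| + 1)) with hηdef
  have hε4 : ε ≤ 1 / 4 := by
    rw [hεdef, div_le_div_iff₀ (by positivity) (by norm_num)]
    nlinarith [mul_nonneg hL (Nat.cast_nonneg (α := ℝ) n)]
  have hLε : L * (n * ε) ≤ 1 / 4 := by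
    rw [hεdef, ← mul_assoc, mul_one_div, div_le_div_iff₀ (by positivity) (by norm_num)]
    linarith
  have hηT : η * T ≤ 1 / 4 := by
    rw [hηdef, one_div_mul_eq_div, div_le_div_iff₀ (by positivity) (by norm_num)]
    linarith [le_abs_self T]
  have h1 := hε m
  rw [if_pos rfl] at h1
  have h2 : ∀ k, k ≠ m → (∑ r, if out r = m then
      ‖dot (localAct (A r) (B r) (C r) ψ) (b k)‖ ^ 2 else 0) ≤ ε := by
    intro k hk
    have := hε k
    rw [if_neg hk, sub_zero] at this
    convert (le_abs_self _).trans this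
  have hε0 : 0 ≤ ε := by positivity
  have h3 : (∑ r, if out r = m then ‖dot (localAct (A r) (B r) (C r) ψ) (b m)‖ ^ 2 else 0) ≤
      L * (n * ε) + η * T := by
    calc _ ≤ ∑ r, (L * (∑ k with k ≠ m, if out r = m then
            ‖dot (localAct (A r) (B r) (C r) ψ) (b k)‖ ^ 2 else 0) +
            η * (weight (A r) * weight (B r) * weight (C r))) := by
          refine Finset.sum_le_sum fun r _ => ?_
          by_cases hr : out r = m
          · simpa only [hr, if_true] using hb (A r) (B r) (C r)
          · simp only [hr, if_false, Finset.sum_const_zero, mul_zero, zero_add]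
            have := weight_nonneg (A r)
            have := weight_nonneg (B r)
            have := weight_nonneg (C r)
            positivity
      _ = L * (∑ k with k ≠ m, ∑ r, if out r = m then
            ‖dot (localAct (A r) (B r) (C r) ψ) (b k)‖ ^ 2 else 0) + η * T := by
          rw [Finset.sum_add_distrib, ← Finset.mul_sum, ← Finset.mul_sum, hw, Finset.sum_comm]
      _ ≤ _ := by
          gcongr
          calc _ ≤ ∑ k with k ≠ m, ε :=
                Finset.sum_le_sum fun k hk => h2 k (Finset.mem_filter.mp hk).2
            _ ≤ _ := by
                rw [Finset.sum_const, nsmul_eq_mul]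
                gcongr
                exact (Finset.card_filter_le _ _).trans_eq (by simp)
  have h4 := (abs_le.mp h1).1
  have h5 : 1 - ε ≤ (∑ r, if out r = m then
      ‖dot (localAct (A r) (B r) (C r) ψ) (b m)‖ ^ 2 else 0) := by
    convert (by linarith : 1 - ε ≤ _)
  linarith

/-- A vector whose dual annihilates all basis states but one is a multiple of the conjugate of that
state. -/
theorem eq_smul_conj_of_dot_eq_zero {ω : ℂ} (hω : ω ^ 3 = 1) (hω' : ω.im ≠ 0) {g : Qubits}
    {m : Fin 8} (h : ∀ k, k ≠ m → dot g (completedBasis ω k) = 0) (t : Fin 2 × Fin 2 × Fin 2) :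
    g t = dot g (completedBasis ω m) * (starRingEnd ℂ) (completedBasis ω m t) := by
  let b := OrthonormalBasis.mk (orthonormal_completedBasis hω hω') (span_completedBasis hω hω').ge
  -- Conjugating `g` turns the bilinear pairing into the inner product, up to conjugation.
  let s : Qubits := WithLp.toLp 2 fun t => (starRingEnd ℂ) (g t)
  have hin : ∀ k, inner ℂ (completedBasis ω k) s =
      (starRingEnd ℂ) (dot g (completedBasis ω k)) := by
    intro k
    simp only [inner_eq_sum, dot, s, map_sum, map_mul, mul_comm]
  have hb := b.sum_repr' s
  simp only [b, OrthonormalBasis.coe_mk, hin] at hb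
  rw [Finset.sum_eq_single m (fun k _ hk => by rw [h k hk, map_zero, zero_smul])
    (fun hm => absurd (Finset.mem_univ m) hm)] at hb
  have ht := congrArg (fun v : Qubits => (starRingEnd ℂ) (v t)) hb
  simpa [s] using ht.symm

/-- No three-qubit vector can be transformed locally into duals of both the first, GHZ-type, state
and the fifth, W-type, state. -/
theorem not_forall_exists_localAct_dual {ω : ℂ} (hω : ω ^ 3 = 1) (hω' : ω.im ≠ 0) (ψ : Qubits) :
    ¬ ∀ m, ∃ A B C, (∀ k, k ≠ m → dot (localAct A B C ψ) (completedBasis ω k) = 0) ∧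
      dot (localAct A B C ψ) (completedBasis ω m) ≠ 0 := by
  intro h
  obtain ⟨A, B, C, h0, hne⟩ := h (Fin.castSucc 0)
  obtain ⟨A', B', C', h0', hne'⟩ := h (Fin.castSucc 4)
  have e := eq_smul_conj_of_dot_eq_zero hω hω' h0
  have e' := eq_smul_conj_of_dot_eq_zero hω hω' h0'
  set c := dot (localAct A B C ψ) (completedBasis ω (Fin.castSucc 0))
  set c' := dot (localAct A' B' C' ψ) (completedBasis ω (Fin.castSucc 4))
  -- On the conjugate of the first state only the term `4 * v000 * v011 * v101 * v110` of the
  -- hyperdeterminant survives.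
  have hψ : hyperdet ψ ≠ 0 := by
    intro hz
    have h1 := hyperdet_localAct A B C ψ
    rw [hz, mul_zero, hyperdet] at h1
    simp only [e, completedBasis_castSucc] at h1
    simp [sevenStates, ket_apply, hne] at h1
  -- The fifth state has real coefficients, so conjugation leaves it unchanged.
  have hW : localAct A' B' C' ψ = c' • wState := by
    ext ⟨i, j, k⟩
    rw [e', completedBasis_castSucc]
    fin_cases i <;> fin_cases j <;> fin_cases k <;> simp [sevenStates, ket_apply, wState]
  have hdet := det_mul_det_mul_det_ne_zero hne' hW
  have h1 := hyperdet_localAct A' B' C' ψ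
  rw [hW, hyperdet_smul] at h1
  have h2 : hyperdet wState = 0 := by simp [hyperdet, wState, ket_apply]
  rw [h2, mul_zero] at h1
  exact mul_ne_zero (pow_ne_zero 2 hdet) hψ h1.symm

theorem norm_sq_inner_completedBasis {ω : ℂ} (hω : ω ^ 3 = 1) (hω' : ω.im ≠ 0) (m k : Fin 8) :
    ‖inner ℂ (completedBasis ω m) (completedBasis ω k)‖ ^ 2 = if k = m then 1 else 0 := by
  rw [orthonormal_iff_ite.mp (orthonormal_completedBasis hω hω')]
  by_cases h : m = k
  · simp [h]
  · simp [h, Ne.symm h]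

theorem not_LOCCImplementableWith {ω : ℂ} (hω : ω ^ 3 = 1) (hω' : ω.im ≠ 0) (ψ : Qubits) :
    ¬ LOCCImplementableWith ψ (completedBasis ω) := by
  intro himp
  refine not_forall_exists_localAct_dual hω hω' ψ fun m =>
    exists_localAct_dual ψ _ m ((2 * 2 : ℕ) * (2 * 2 : ℕ) * (2 * 2 : ℕ)) fun ε hε => ?_
  obtain ⟨P, hP⟩ := himp ε hε
  obtain ⟨ι, hι, α, β, γ, out, hprob, hnorm⟩ := P.exists_productFunctional
  refine ⟨ι, hι, fun r => unflatten (α r), fun r => unflatten (β r), fun r => unflatten (γ r), out,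
    ?_, fun k => ?_⟩
  · simp only [weight, sum_unflatten]
    exact sum_weight_eq hnorm
  -- Testing the protocol on the basis states themselves suffices.
  · have h := hP (completedBasis ω k) ((orthonormal_completedBasis hω hω').1 k) m
    rw [hprob, norm_sq_inner_completedBasis hω hω'] at h
    simpa only [productFunctional_tensor] using h

/-- The matrix with first column `α` and second column zero. -/
def firstColumn (α : Fin 2 → ℂ) : Matrix (Fin 2) (Fin 2) ℂ := fun i j => if j = 0 then α i else 0

theorem weight_firstColumn (α : Fin 2 → ℂ) : weight (firstColumn α) = ∑ i, ‖α i‖ ^ 2 := by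
  simp [weight, firstColumn, Fin.sum_univ_two]

/-- Every product vector is a local transform of `|000⟩`, so the unassisted case reduces to the same
compactness argument. -/
theorem productFunctional_eq_dot (α β γ : Fin 2 → ℂ) (χ : Qubits) :
    productFunctional α β γ χ =
      dot (localAct (firstColumn α) (firstColumn β) (firstColumn γ) (ket 0 0 0)) χ := by
  simp [productFunctional, dot, localAct, actA, actB, actC, firstColumn, Fin.sum_univ_two,
    ket_apply, mul_assoc]

theorem not_LOCCImplementable {ω : ℂ} (hω : ω ^ 3 = 1) (hω' : ω.im ≠ 0) :
    ¬ LOCCImplementable (completedBasis ω) := by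
  intro himp
  refine not_forall_exists_localAct_dual hω hω' (ket 0 0 0) fun m =>
    exists_localAct_dual (ket 0 0 0) _ m ((2 : ℕ) * (2 : ℕ) * (2 : ℕ)) fun ε hε => ?_
  obtain ⟨P, hP⟩ := himp ε hε
  obtain ⟨ι, hι, α, β, γ, out, hprob, hnorm⟩ := P.exists_productFunctional
  refine ⟨ι, hι, fun r => firstColumn (α r), fun r => firstColumn (β r),
    fun r => firstColumn (γ r), out, ?_, fun k => ?_⟩
  · simp only [weight_firstColumn]
    exact sum_weight_eq hnorm
  · have h := hP (completedBasis ω k) ((orthonormal_completedBasis hω hω').1 k) m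
    rw [hprob, norm_sq_inner_completedBasis hω hω'] at h
    simpa only [productFunctional_eq_dot] using h

end ThreeQubit

end

theorem theorem2 (ω : ℂ) (hω : ω ^ 3 = 1) (hω' : ω.im ≠ 0) :
    -- four GHZ-class states and three W-class states
    (∀ m : Fin 7, m.val < 4 → ThreeQubit.IsGHZClass (ThreeQubit.sevenStates ω m)) ∧
    (∀ m : Fin 7, 4 ≤ m.val → ThreeQubit.IsWClass (ThreeQubit.sevenStates ω m)) ∧
    -- unextendible entangled basis of cardinality seven, also across every bipartition
    (Set.range (ThreeQubit.sevenStates ω)).ncard = 7 ∧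
    ThreeQubit.IsUEB ThreeQubit.IsFullyProduct (ThreeQubit.sevenStates ω) ∧
    (∀ cut : ThreeQubit.Cut,
      ThreeQubit.IsUEB (ThreeQubit.IsProductAcross cut) (ThreeQubit.sevenStates ω)) ∧
    -- the complement is spanned by `|111⟩`, which completes the states to an orthonormal basis
    (Submodule.span ℂ (Set.range (ThreeQubit.sevenStates ω)))ᗮ =
      Submodule.span ℂ {ThreeQubit.ket 1 1 1} ∧
    Orthonormal ℂ (ThreeQubit.completedBasis ω) ∧
    Submodule.span ℂ (Set.range (ThreeQubit.completedBasis ω)) = ⊤ ∧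
    -- the measurement in the completed basis is nonlocal
    ¬ ThreeQubit.LOCCImplementable (ThreeQubit.completedBasis ω) ∧
    -- and it stays so with any pure three-qubit state as a resource
    (∀ ψ : ThreeQubit.Qubits, ‖ψ‖ = 1 →
      ¬ ThreeQubit.LOCCImplementableWith ψ (ThreeQubit.completedBasis ω)) := by
  have hcut := ThreeQubit.not_isProductAcross_sevenStates hω
  have horth := ThreeQubit.orthonormal_sevenStates hω hω'
  refine ⟨ThreeQubit.isGHZClass_sevenStates ω, ThreeQubit.isWClass_sevenStates hω, ?_,
    ThreeQubit.isUEB_sevenStates hω hω' _ (fun m h => hcut .A_BC m (h.isProductAcross _))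
      fun _ h => h,
    fun cut => ThreeQubit.isUEB_sevenStates hω hω' _ (hcut cut) fun _ h => h.isProductAcross cut,
    ThreeQubit.orthogonal_span_sevenStates hω hω', ThreeQubit.orthonormal_completedBasis hω hω',
    ThreeQubit.span_completedBasis hω hω', ThreeQubit.not_LOCCImplementable hω hω',
    fun ψ _ => ThreeQubit.not_LOCCImplementableWith hω hω' ψ⟩
  rw [← Set.image_univ, Set.ncard_image_of_injective _ horth.linearIndependent.injective,
    Set.ncard_univ, Nat.card_fin]
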